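/- Let $R$ be an ordered ring (a commutative unital ring with $1\neq 0$ and a total order compatible with addition and multiplication, products of positive elements being positive), let $C=R(i)$ with $i^2=-1$ and complex conjugation $z\mapsto\bar z$; for $z\in C$, $z\ge 0$ means that $z$ lies in $R$ and is $\ge 0$ there, and similarly for $z>0$. A unital $*$-algebra over $C$ is a unital associative $C$-algebra with an antilinear involutive antiautomorphism $a\mapsto a^*$; modules over it and bimodules are unital and compatible with the $C$-module structure. A pre-Hilbert space $H$ is a $C$-module with a Hermitian inner product, $C$-linear in the second argument, with $\langle\phi,\phi\rangle>0$ for $\phi\ne 0$. A $*$-representation $(\pi,H)$ of a $*$-algebra $A$ is a $*$-homomorphism $\pi$ from $A$ into the adjointable operators on a pre-Hilbert space $H$. $\mathrm{Rep}(A)$ is the category of $*$-representations with $\pi(A)H=H$, whose morphisms are the $C$-linear maps $U$ with $U\pi(a)=\rho(a)U$ for all $a\in A$ and $\langle U\phi,U\psi\rangle=\langle\phi,\psi\rangle$. An element $a=a^*\in A$ is positive, $a\in A^+$, if $\omega(a)\ge 0$ for all $C$-linear $\omega:A\to C$ such that $\omega(b^*b)\ge0$ for all $b\in A$. Let $A,B$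 be unital $*$-algebras over $C$. A Morita equivalence bimodule is a $B$-$A$-bimodule $E$ with maps $\langle\cdot,\cdot\rangle:E\times E\to A$ and $\Theta:E\times E\to B$ such that, for all $x,y,z\in E$, $a\in A$, $b\in B$: 1. $\langle\cdot,\cdot\rangle$ is biadditive, $C$-linear in the second argument, $\langle x,y\rangle=\langle y,x\rangle^*$, $\langle x,y\cdot a\rangle=\langle x,y\rangle a$, $\langle x,x\rangle\in A^+$, and $\langle b\cdot x,y\rangle=\langle x,b^*\cdot y\rangle$. 2. $\Theta$ is biadditive, $C$-linear in the first argument, $\Theta_{x,y}=\Theta_{y,x}^*$, $\Theta_{b\cdot x,y}=b\,\Theta_{x,y}$, $\Theta_{x,x}\in B^+$, and $\Theta_{x,y\cdot a}=\Theta_{x\cdot a^*,y}$. 3. (Positivity) For every $*$-representation $(\pi,H)$ of $A$, $\langle x\otimes\phi,y\otimes\psi\rangle=\langle\phi,\pi(\langle x,y\rangle)\psi\rangle$ extends to a positive semidefinite Hermitian inner product on $E\otimes_A H$; and for every $*$-representation $(\rho,K)$ of $B$, $\langle\bar x\otimes\phi,\bar y\otimes\psi\rangle=\langle\phi,\rho(\Theta_{x,y})\psi\rangle$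 extends to one on $\bar E\otimes_B K$. Here $\bar E$ is the conjugate $A$-$B$-bimodule: $\bar E=E$ as an additive group via $x\mapsto\bar x$, with $c\,\bar x=\overline{\bar c\,x}$ for $c\in C$, $a\cdot\bar x=\overline{x\cdot a^*}$, $\bar x\cdot b=\overline{b^*\cdot x}$. 4. (Compatibility) $\Theta_{x,y}\cdot z=x\cdot\langle y,z\rangle$. 5. (Fullness) $A=C\text{-span}\{\langle x,y\rangle\}$ and $B=C\text{-span}\{\Theta_{x,y}\}$. The Rieffel induction functor $\mathsf R_E:\mathrm{Rep}(A)\to\mathrm{Rep}(B)$ sends $(\pi,H)$ to the quotient of $E\otimes_A H$ by its vectors of length zero, with $B$ acting by $b\cdot[x\otimes\phi]=[(b\cdot x)\otimes\phi]$, and an isometric intertwiner $U$ to $[x\otimes\phi]\mapsto[x\otimes U\phi]$. **Theorem.** Let $A$, $B$ be unital $*$-algebras over $C$ and let $E$ with $\langle\cdot,\cdot\rangle$ and $\Theta$ be a Morita equivalence bimodule. (i) $\bar E$, with the $B$-valued inner product $\langle\bar x,\bar y\rangle=\Theta_{x,y}$ and the $A$-valued inner product $\bar\Theta_{\bar x,\bar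 y}=\langle x,y\rangle$, is a Morita equivalence bimodule as well (with the roles of $A$ and $B$ exchanged), and the functors $\mathsf R_E:\mathrm{Rep}(A)\to\mathrm{Rep}(B)$ and $\mathsf R_{\bar E}:\mathrm{Rep}(B)\to\mathrm{Rep}(A)$ form an equivalence of categories, inverse to each other up to natural isomorphism. (ii) $A$ and $B$ are Morita equivalent as unital rings, and $E$ is finitely generated and projective both as a right $A$-module and as a left $B$-module. -/

import Mathlib

universe u

namespace StarMorita

open CategoryTheory TensorProduct MulOpposite

/-! ### The ring `C = R(i)` -/

/-- `C = R(i)` with `i ^ 2 = -1`; its star operation is complex conjugation. -/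
abbrev Cx (R : Type u) [CommRing R] : Type u := QuadraticAlgebra R (-1) 0

section Scalars

variable {R : Type u} [CommRing R] [LinearOrder R]

/-- `z ≥ 0` in `C = R(i)`: `z` lies in `R` and is `≥ 0` there. -/
def Nonneg (z : Cx R) : Prop := z.im = 0 ∧ 0 ≤ z.re

/-- `z > 0` in `C = R(i)`: `z` lies in `R` and is `> 0` there. -/
def Pos (z : Cx R) : Prop := z.im = 0 ∧ 0 < z.re

end Scalars

/-! ### Pre-Hilbert spaces over `C` -/

/-- A pre-Hilbert space over `C = R(i)`: a `C`-module with a positive definite Hermitian inner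
product, `C`-linear in the second argument. -/
structure PreHilb (R : Type u) [CommRing R] [LinearOrder R] : Type (u + 1) where
  carrier : Type u
  [addCommGroup : AddCommGroup carrier]
  [module : Module (Cx R) carrier]
  inner : carrier → carrier → Cx R
  inner_add_right : ∀ φ ψ χ, inner φ (ψ + χ) = inner φ ψ + inner φ χ
  inner_smul_right : ∀ φ (z : Cx R) ψ, inner φ (z • ψ) = z * inner φ ψ
  inner_conj_symm : ∀ φ ψ, inner φ ψ = star (inner ψ φ)
  inner_pos : ∀ φ, φ ≠ 0 → Pos (inner φ φ)

instance {R : Type u} [CommRing R] [LinearOrder R] : CoeSort (PreHilb.{u} R) (Type u) where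
  coe H := H.carrier

instance {R : Type u} [CommRing R] [LinearOrder R] (H : PreHilb.{u} R) : AddCommGroup H :=
  H.addCommGroup

instance {R : Type u} [CommRing R] [LinearOrder R] (H : PreHilb.{u} R) : Module (Cx R) H :=
  H.module

/-- `S` is the adjoint of the linear map `T`. -/
def IsAdjoint {R : Type u} [CommRing R] [LinearOrder R] {H K : PreHilb.{u} R}
    (T : H →ₗ[Cx R] K) (S : K →ₗ[Cx R] H) : Prop :=
  ∀ φ ψ, K.inner (T φ) ψ = H.inner φ (S ψ)

/-! ### `*`-representations -/

section Representations

variable (R : Type u) [CommRing R] [LinearOrder R]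
  (A : Type u) [Ring A] [StarRing A] [Algebra (Cx R) A]

/-- A `*`-representation of `A` on a pre-Hilbert space `H`, i.e. a (not necessarily unital)
`*`-homomorphism from `A` to the `*`-algebra of adjointable operators on `H`: a homomorphism `π` of
algebras such that every `π a` is adjointable with adjoint `π (star a)`. -/
structure StarRep : Type (u + 1) where
  space : PreHilb.{u} R
  π : A →ₙₐ[Cx R] Module.End (Cx R) space
  isAdjoint : ∀ a, IsAdjoint (π a) (π (star a))

/-- The objects of the category `Rep(A)`: the strongly nondegenerate `*`-representations, i.e. those
with `π(A) H = H`. -/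
structure RepCat : Type (u + 1) extends StarRep R A where
  nondegenerate : Submodule.span (Cx R) {v : space | ∃ a φ, v = π a φ} = ⊤

variable {R A}

/-- Isometric intertwiners between `*`-representations. -/
@[ext]
structure StarRep.Hom (π ρ : StarRep R A) : Type u where
  toLin : π.space →ₗ[Cx R] ρ.space
  intertwines : ∀ a φ, toLin (π.π a φ) = ρ.π a (toLin φ)
  isometric : ∀ φ ψ, ρ.space.inner (toLin φ) (toLin ψ) = π.space.inner φ ψ

/-- The category `Rep(A)` of strongly nondegenerate `*`-representations of `A` on pre-Hilbert
spaces, with isometric intertwiners as morphisms. -/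
instance : Category.{u} (RepCat R A) where
  Hom π ρ := StarRep.Hom π.toStarRep ρ.toStarRep
  id π := ⟨LinearMap.id, fun _ _ => rfl, fun _ _ => rfl⟩
  comp U V := ⟨V.toLin ∘ₗ U.toLin,
    fun a φ => by simp [U.intertwines, V.intertwines],
    fun φ ψ => by simp [U.isometric, V.isometric]⟩

end Representations

/-! ### Positive elements and inner products with values in a `*`-algebra -/

section InnerProducts

variable {R : Type u} [CommRing R] [LinearOrder R]

/-- A linear functional `ω : A → C` is positive if `ω(a* a) ≥ 0` for all `a`. -/
def IsPositiveFunctional {A : Type u} [Ring A] [StarRing A] [Algebra (Cx R) A]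
    (ω : A →ₗ[Cx R] Cx R) : Prop :=
  ∀ a, Nonneg (ω (star a * a))

variable (R) in
/-- The positive elements `A⁺`: Hermitian elements on which all positive linear functionals are
nonnegative. -/
def IsPositiveElement {A : Type u} [Ring A] [StarRing A] [Algebra (Cx R) A] (a : A) : Prop :=
  star a = a ∧ ∀ ω : A →ₗ[Cx R] Cx R, IsPositiveFunctional ω → Nonneg (ω a)

variable {A : Type u} [Ring A] [StarRing A] [Algebra (Cx R) A]
  {B : Type u} [Ring B] [StarRing B] [Algebra (Cx R) B]
  {E : Type u} [AddCommGroup E] [Module (Cx R) E]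

variable (R) in
/-- `A`-valued, `A`-right linear Hermitian inner products on a right `A`-module `E`
(a right `A`-module is a left `Aᵐᵒᵖ`-module; `op a • x` is `x · a`). -/
structure IsRightInner [Module Aᵐᵒᵖ E] (ip : E → E → A) : Prop where
  add_right : ∀ x y z, ip x (y + z) = ip x y + ip x z
  smul_right : ∀ x (c : Cx R) y, ip x (c • y) = c • ip x y
  symm : ∀ x y, ip x y = star (ip y x)
  mul_right : ∀ x y (a : A), ip x (op a • y) = ip x y * a
  pos : ∀ x, IsPositiveElement R (ip x x)

variable (R) in
/-- `B`-valued, `B`-left linear Hermitian inner products on a left `B`-module `E`. -/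
structure IsLeftInner [Module B E] (Θ : E → E → B) : Prop where
  add_left : ∀ x y z, Θ (x + y) z = Θ x z + Θ y z
  smul_left : ∀ (c : Cx R) x y, Θ (c • x) y = c • Θ x y
  symm : ∀ x y, Θ x y = star (Θ y x)
  mul_left : ∀ (b : B) x y, Θ (b • x) y = b * Θ x y
  pos : ∀ x, IsPositiveElement R (Θ x x)

variable (E) in
/-- The relations `(x · a) ⊗ φ = x ⊗ π(a) φ` inside `E ⊗ H`. -/
def balancing [Module Aᵐᵒᵖ E] (π : StarRep R A) : Submodule (Cx R) (E ⊗[Cx R] π.space) :=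
  Submodule.span (Cx R) {t | ∃ (x : E) (a : A) (φ : π.space),
    t = (op a • x) ⊗ₜ[Cx R] φ - x ⊗ₜ[Cx R] (π.π a φ)}

variable (E) in
/-- The tensor product `E ⊗_A H` over the noncommutative algebra `A`. -/
abbrev BalTensor [Module Aᵐᵒᵖ E] (π : StarRep R A) : Type u :=
  (E ⊗[Cx R] π.space) ⧸ balancing E π

/-- The elementary tensor `x ⊗ φ` in `E ⊗_A H`. -/
def balTmul [Module Aᵐᵒᵖ E] (π : StarRep R A) (x : E) (φ : π.space) : BalTensor E π :=
  Submodule.Quotient.mk (x ⊗ₜ[Cx R] φ)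

/-- `s` is a positive semidefinite Hermitian inner product on `E ⊗_A H` which extends
`⟨x ⊗ φ, y ⊗ ψ⟩ = ⟨φ, π(⟨x, y⟩) ψ⟩`. -/
structure IsInducedForm [Module Aᵐᵒᵖ E] (ip : E → E → A) (π : StarRep R A)
    (s : BalTensor E π →ₗ⋆[Cx R] BalTensor E π →ₗ[Cx R] Cx R) : Prop where
  tmul : ∀ x φ y ψ, s (balTmul π x φ) (balTmul π y ψ) = π.space.inner φ (π.π (ip x y) ψ)
  symm : ∀ k l, s k l = star (s l k)
  nonneg : ∀ k, Nonneg (s k k)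

variable (R) in
/-- The positivity condition **P**, for all `*`-representations `π` of `A`. -/
def PositivityP [Module Aᵐᵒᵖ E] (ip : E → E → A) : Prop :=
  ∀ π : StarRep R A, ∃ s, IsInducedForm ip π s

variable (R B) in
/-- The requirements for Rieffel induction on a `B`-`A` bimodule `E`: an `A`-valued inner product,
compatible with the left `B`-action, which satisfies **P**. -/
structure IsRieffel [Module B E] [Module Aᵐᵒᵖ E] (ip : E → E → A) : Prop where
  inner : IsRightInner R ip
  compat : ∀ (b : B) x y, ip (b • x) y = ip x (star b • y)
  positivity : PositivityP R ip

end InnerProducts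

/-! ### The conjugate bimodule -/

/-- The complex conjugate `Ē` of `E`; it is `E` as an additive group. -/
def Conj (E : Type u) : Type u := E

/-- The identity map `x ↦ x̄` from `E` to `Ē`. -/
def toConj {E : Type u} (x : E) : Conj E := x

/-- The identity map `x̄ ↦ x` from `Ē` to `E`. -/
def ofConj {E : Type u} (x : Conj E) : E := x

section Conjugate

variable {R : Type u} [CommRing R]
  {A : Type u} [Ring A] [StarRing A] [Algebra (Cx R) A] [StarModule (Cx R) A]
  {B : Type u} [Ring B] [StarRing B] [Algebra (Cx R) B] [StarModule (Cx R) B]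
  {E : Type u} [AddCommGroup E] [Module (Cx R) E] [Module B E] [Module Aᵐᵒᵖ E]
  [IsScalarTower (Cx R) B E] [IsScalarTower (Cx R) Aᵐᵒᵖ E] [SMulCommClass B Aᵐᵒᵖ E]

instance : AddCommGroup (Conj E) := inferInstanceAs (AddCommGroup E)

/-- `c · x̄` is the conjugate of `c̄ · x`. -/
instance : Module (Cx R) (Conj E) where
  smul c x := toConj (star c • ofConj x)
  one_smul x := show star (1 : Cx R) • ofConj x = ofConj x by rw [star_one, one_smul]
  mul_smul c d x := show star (c * d) • ofConj x = star c • star d • ofConj x by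
    rw [star_mul', mul_smul]
  smul_zero c := show star c • (0 : E) = 0 from smul_zero _
  smul_add c x y := show star c • (ofConj x + ofConj y) = star c • ofConj x + star c • ofConj y from
    smul_add _ _ _
  add_smul c d x := show star (c + d) • ofConj x = star c • ofConj x + star d • ofConj x by
    rw [star_add, add_smul]
  zero_smul x := show star (0 : Cx R) • ofConj x = 0 by rw [star_zero, zero_smul]

/-- `a · x̄` is the conjugate of `x · a*`. -/
instance conjLeftModule : Module A (Conj E) where
  smul a x := toConj (op (star a) • ofConj x)
  one_smul x := show op (star (1 : A)) • ofConj x = ofConj x by rw [star_one, op_one, one_smul]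
  mul_smul a b x := show op (star (a * b)) • ofConj x = op (star a) • op (star b) • ofConj x by
    rw [star_mul, op_mul, mul_smul]
  smul_zero a := show op (star a) • (0 : E) = 0 from smul_zero _
  smul_add a x y := show op (star a) • (ofConj x + ofConj y)
      = op (star a) • ofConj x + op (star a) • ofConj y from smul_add _ _ _
  add_smul a b x := show op (star (a + b)) • ofConj x
      = op (star a) • ofConj x + op (star b) • ofConj x by
    rw [star_add, ← add_smul]; rfl
  zero_smul x := show op (star (0 : A)) • ofConj x = 0 by rw [star_zero, op_zero, zero_smul]

/-- `x̄ · b` is the conjugate of `b* · x`. -/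
instance conjRightModule : Module Bᵐᵒᵖ (Conj E) where
  smul b x := toConj (star b.unop • ofConj x)
  one_smul x := show star (1 : B) • ofConj x = ofConj x by rw [star_one, one_smul]
  mul_smul a b x := show star (b.unop * a.unop) • ofConj x
      = star a.unop • star b.unop • ofConj x by rw [star_mul, mul_smul]
  smul_zero a := show star a.unop • (0 : E) = 0 from smul_zero _
  smul_add a x y := show star a.unop • (ofConj x + ofConj y)
      = star a.unop • ofConj x + star a.unop • ofConj y from smul_add _ _ _
  add_smul a b x := show star (a.unop + b.unop) • ofConj x
      = star a.unop • ofConj x + star b.unop • ofConj x by rw [star_add, add_smul]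
  zero_smul x := show star (0 : B) • ofConj x = 0 by rw [star_zero, zero_smul]

instance : IsScalarTower (Cx R) A (Conj E) where
  smul_assoc c a x := show op (star (c • a)) • ofConj x = star c • op (star a) • ofConj x by
    rw [star_smul, op_smul, smul_assoc]

instance : IsScalarTower (Cx R) Bᵐᵒᵖ (Conj E) where
  smul_assoc c b x := show star (c • b.unop) • ofConj x = star c • star b.unop • ofConj x by
    rw [star_smul, smul_assoc]

instance : SMulCommClass A Bᵐᵒᵖ (Conj E) where
  smul_comm a b x := show op (star a) • star b.unop • ofConj x
      = star b.unop • op (star a) • ofConj x from (smul_comm _ _ _).symm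

/-- An `X`-valued inner product on `E`, read on the conjugate `Ē`: `(x̄, ȳ) ↦ f(x, y)`. -/
def conjInner {X : Type u} (f : E → E → X) : Conj E → Conj E → X :=
  fun x y => f (ofConj x) (ofConj y)

end Conjugate

/-! ### Morita equivalence bimodules -/

section Morita

variable (R : Type u) [CommRing R] [LinearOrder R]
  {A : Type u} [Ring A] [StarRing A] [Algebra (Cx R) A]
  {B : Type u} [Ring B] [StarRing B] [Algebra (Cx R) B]
  {E : Type u} [AddCommGroup E] [Module (Cx R) E] [Module B E] [Module Aᵐᵒᵖ E]

/-- A `B`-`A` bimodule `E` with inner products `ip` (values in `A`, right linear) and `Θ` (values in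
`B`, left linear) is a Morita equivalence bimodule. The positivity condition for `Θ` is condition
**P** for the `B`-valued right linear inner product `(x̄, ȳ) ↦ Θ(x, y)` on `Ē`: the form
`⟨x̄ ⊗ φ, ȳ ⊗ ψ⟩ = ⟨φ, ρ(Θ(x, y)) ψ⟩` on `Ē ⊗_B K` is positive semidefinite for all
`*`-representations `(ρ, K)` of `B`. -/
structure IsMoritaBimodule (ip : E → E → A) (Θ : E → E → B) : Prop where
  inner : IsRightInner R ip
  inner_compat : ∀ (b : B) x y, ip (b • x) y = ip x (star b • y)
  inner_positivity : PositivityP R ip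
  theta : IsLeftInner R Θ
  theta_compat : ∀ x y (a : A), Θ x (op a • y) = Θ (op (star a) • x) y
  theta_positivity : PositivityP R (conjInner Θ)
  compat : ∀ x y z, Θ x y • z = op (ip y z) • x
  inner_full : Submodule.span (Cx R) {a : A | ∃ x y, a = ip x y} = ⊤
  theta_full : Submodule.span (Cx R) {b : B | ∃ x y, b = Θ x y} = ⊤

variable {R}

theorem IsMoritaBimodule.isRieffel {ip : E → E → A} {Θ : E → E → B}
    (h : IsMoritaBimodule R ip Θ) : IsRieffel R B ip :=
  ⟨h.inner, h.inner_compat, h.inner_positivity⟩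

end Morita

/-! ### Rieffel induction -/

set_option linter.unusedSectionVars false

section Rieffel

variable {R : Type u} [CommRing R] [LinearOrder R] [IsStrictOrderedRing R]
  {A : Type u} [Ring A] [StarRing A] [Algebra (Cx R) A]
  {B : Type u} [Ring B] [StarRing B] [Algebra (Cx R) B]
  {E : Type u} [AddCommGroup E] [Module (Cx R) E]

/-- Vectors of length zero are orthogonal to everything (a consequence of the Cauchy-Schwarz
inequality). -/
theorem eq_zero_of_self {K : Type u} [AddCommGroup K] [Module (Cx R) K]
    (s : K →ₗ⋆[Cx R] K →ₗ[Cx R] Cx R) (hs : ∀ k l, s k l = star (s l k))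
    (h0 : ∀ k, Nonneg (s k k)) {k : K} (hk : s k k = 0) (l : K) : s l k = 0 := by
  set p := (s l l).re with hp
  set b := s l k with hb
  have hp0 : 0 ≤ p := (h0 l).2
  set N : R := b.re * b.re + b.im * b.im with hN
  by_contra hne
  have hNpos : 0 < N := by
    rcases lt_or_eq_of_le (add_nonneg (mul_self_nonneg b.re) (mul_self_nonneg b.im)) with h | h
    · exact h
    · exfalso
      apply hne
      have h1 : b.re * b.re = 0 := by nlinarith [mul_self_nonneg b.re, mul_self_nonneg b.im]
      have h2 : b.im * b.im = 0 := by nlinarith [mul_self_nonneg b.re, mul_self_nonneg b.im]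
      exact QuadraticAlgebra.ext (mul_self_eq_zero.mp h1) (mul_self_eq_zero.mp h2)
  have hkl : s k l = star b := hs k l
  have key := (h0 ((⟨N, 0⟩ : Cx R) • l + ((⟨-(p + 1), 0⟩ : Cx R) * star b) • k)).2
  simp only [map_add, LinearMap.add_apply, LinearMap.map_smulₛₗ, LinearMap.smul_apply, map_smul,
    hk, hkl, ← hb, smul_eq_mul, starRingEnd_apply] at key
  simp only [QuadraticAlgebra.re_add, QuadraticAlgebra.re_mul, QuadraticAlgebra.im_mul,
    QuadraticAlgebra.im_star, QuadraticAlgebra.re_star, star_mul', star_star, QuadraticAlgebra.im_add,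
    ← hp, mul_zero, QuadraticAlgebra.re_zero, QuadraticAlgebra.im_zero, (h0 l).1] at key
  have : N * N * (p + 2) ≤ 0 := by
    rw [hN]
    rw [hN] at key
    nlinarith [key]
  have h2 : 0 < N * N * (p + 2) := by positivity
  exact absurd this (not_le.mpr h2)

/-- The submodule of vectors of length zero of a positive semidefinite form. -/
def nullSpace {K : Type u} [AddCommGroup K] [Module (Cx R) K]
    (s : K →ₗ⋆[Cx R] K →ₗ[Cx R] Cx R) (hs : ∀ k l, s k l = star (s l k))
    (h0 : ∀ k, Nonneg (s k k)) : Submodule (Cx R) K where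
  carrier := {k | s k k = 0}
  zero_mem' := by simp
  add_mem' {k l} hk hl := by
    have h1 := eq_zero_of_self s hs h0 hk
    have h2 := eq_zero_of_self s hs h0 hl
    show s (k + l) (k + l) = 0
    rw [map_add, h1, h2, add_zero]
  smul_mem' c k hk := by
    show s (c • k) (c • k) = 0
    rw [map_smul, eq_zero_of_self s hs h0 hk, smul_zero]

/-- The quotient of a space with positive semidefinite form by the vectors of length zero, as a
pre-Hilbert space. -/
def quotientPreHilb {K : Type u} [AddCommGroup K] [Module (Cx R) K]
    (s : K →ₗ⋆[Cx R] K →ₗ[Cx R] Cx R) (hs : ∀ k l, s k l = star (s l k))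
    (h0 : ∀ k, Nonneg (s k k)) : PreHilb.{u} R where
  carrier := K ⧸ nullSpace s hs h0
  inner x y := Quotient.liftOn₂' x y (fun k l => s k l) (by
    intro k l k' l' hk hl
    rw [Submodule.quotientRel_def] at hk hl
    have h1 : s k (l - l') = 0 := eq_zero_of_self s hs h0 hl k
    have h2 : s (k - k') l' = 0 := by rw [hs, eq_zero_of_self s hs h0 hk l', star_zero]
    rw [map_sub, sub_eq_zero] at h1
    rw [map_sub, LinearMap.sub_apply, sub_eq_zero] at h2
    exact h1.trans h2)
  inner_add_right := by
    rintro ⟨k⟩ ⟨l⟩ ⟨m⟩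
    exact map_add (s k) l m
  inner_smul_right := by
    rintro ⟨k⟩ c ⟨l⟩
    exact map_smul (s k) c l
  inner_conj_symm := by
    rintro ⟨k⟩ ⟨l⟩
    exact hs k l
  inner_pos := by
    rintro ⟨k⟩ hk
    refine ⟨(h0 k).1, lt_of_le_of_ne (h0 k).2 fun h => hk ?_⟩
    exact (Submodule.Quotient.mk_eq_zero _).mpr
      (QuadraticAlgebra.ext h.symm (h0 k).1 : s k k = 0)

variable [Module B E] [Module Aᵐᵒᵖ E] {ip : E → E → A}

/-- The inner product `⟨x ⊗ φ, y ⊗ ψ⟩ = ⟨φ, π(⟨x, y⟩) ψ⟩` on `E ⊗_A H`; condition **P** provides it,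
and it is determined by its values on elementary tensors. -/
noncomputable def inducedForm (h : IsRieffel R B ip) (π : StarRep R A) :
    BalTensor E π →ₗ⋆[Cx R] BalTensor E π →ₗ[Cx R] Cx R :=
  (h.positivity π).choose

theorem inducedForm_spec (h : IsRieffel R B ip) (π : StarRep R A) :
    IsInducedForm ip π (inducedForm h π) :=
  (h.positivity π).choose_spec

/-- The pre-Hilbert space `K = (E ⊗_A H) / (E ⊗_A H)^⊥`. -/
noncomputable def rieffelSpace (h : IsRieffel R B ip) (π : StarRep R A) : PreHilb.{u} R :=
  quotientPreHilb (inducedForm h π) (inducedForm_spec h π).symm (inducedForm_spec h π).nonneg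

/-- The class of an element of `E ⊗_A H` in `K`. -/
noncomputable def rieffelMk (h : IsRieffel R B ip) (π : StarRep R A) :
    BalTensor E π →ₗ[Cx R] rieffelSpace h π :=
  Submodule.mkQ (nullSpace (inducedForm h π) (inducedForm_spec h π).symm
    (inducedForm_spec h π).nonneg)

theorem rieffelMk_surjective (h : IsRieffel R B ip) (π : StarRep R A) :
    Function.Surjective (rieffelMk h π) :=
  Submodule.mkQ_surjective _

theorem inner_rieffelMk (h : IsRieffel R B ip) (π : StarRep R A) (k l : BalTensor E π) :
    (rieffelSpace h π).inner (rieffelMk h π k) (rieffelMk h π l) = inducedForm h π k l :=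
  rfl

@[elab_as_elim]
theorem balTensor_induction {π : StarRep R A} {P : BalTensor E π → Prop} (h0 : P 0)
    (ht : ∀ x φ, P (balTmul π x φ)) (ha : ∀ k l, P k → P l → P (k + l)) (k : BalTensor E π) :
    P k := by
  obtain ⟨t, rfl⟩ := Submodule.Quotient.mk_surjective _ k
  induction t using TensorProduct.induction_on with
  | zero => exact h0
  | tmul x φ => exact ht x φ
  | add s t hs ht' => exact ha _ _ hs ht'

section Action

variable [IsScalarTower (Cx R) B E] [SMulCommClass B Aᵐᵒᵖ E]

/-- The left `B`-action `b · (x ⊗ φ) = (b · x) ⊗ φ` on `E ⊗_A H`. -/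
noncomputable def balLeft (π : StarRep R A) (b : B) : BalTensor E π →ₗ[Cx R] BalTensor E π :=
  Submodule.mapQ (balancing E π) (balancing E π)
    (LinearMap.rTensor π.space (Algebra.lsmul (Cx R) (Cx R) E b)) (by
      rw [balancing, Submodule.span_le]
      rintro _ ⟨x, a, φ, rfl⟩
      refine Submodule.subset_span ⟨b • x, a, φ, ?_⟩
      simp [smul_comm b (op a) x])

theorem balLeft_tmul (π : StarRep R A) (b : B) (x : E) (φ : π.space) :
    balLeft π b (balTmul π x φ) = balTmul π (b • x) φ :=
  rfl

theorem inducedForm_balLeft (h : IsRieffel R B ip) (π : StarRep R A) (b : B)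
    (k l : BalTensor E π) :
    inducedForm h π (balLeft π b k) l = inducedForm h π k (balLeft π (star b) l) := by
  induction k using balTensor_induction with
  | h0 => simp
  | ha k k' hk hk' => rw [map_add, map_add, map_add, LinearMap.add_apply, LinearMap.add_apply, hk,
      hk']
  | ht x φ =>
    induction l using balTensor_induction with
    | h0 => simp
    | ha l l' hl hl' => rw [map_add, map_add, map_add, hl, hl']
    | ht y ψ =>
      rw [balLeft_tmul, balLeft_tmul, (inducedForm_spec h π).tmul, (inducedForm_spec h π).tmul,
        h.compat]

/-- The action of `B` on the pre-Hilbert space `K`. -/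
noncomputable def rieffelAct (h : IsRieffel R B ip) (π : StarRep R A) (b : B) :
    Module.End (Cx R) (rieffelSpace h π) :=
  Submodule.mapQ _ _ (balLeft π b) (by
    intro k hk
    show inducedForm h π (balLeft π b k) (balLeft π b k) = 0
    rw [inducedForm_balLeft, (inducedForm_spec h π).symm,
      eq_zero_of_self _ (inducedForm_spec h π).symm (inducedForm_spec h π).nonneg hk, star_zero])

theorem rieffelAct_mk (h : IsRieffel R B ip) (π : StarRep R A) (b : B) (k : BalTensor E π) :
    rieffelAct h π b (rieffelMk h π k) = rieffelMk h π (balLeft π b k) :=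
  rfl

theorem rieffel_ext (h : IsRieffel R B ip) (π : StarRep R A) {M : Type u} [AddCommGroup M]
    [Module (Cx R) M] {f g : rieffelSpace h π →ₗ[Cx R] M}
    (hfg : ∀ x φ, f (rieffelMk h π (balTmul π x φ)) = g (rieffelMk h π (balTmul π x φ))) :
    f = g := by
  ext k
  obtain ⟨k, rfl⟩ := rieffelMk_surjective h π k
  induction k using balTensor_induction with
  | h0 => simp
  | ht x φ => exact hfg x φ
  | ha k l hk hl => rw [map_add, map_add, map_add, hk, hl]

theorem balTmul_add_left (π : StarRep R A) (x y : E) (φ : π.space) :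
    balTmul π (x + y) φ = balTmul π x φ + balTmul π y φ := by
  simp [balTmul, TensorProduct.add_tmul]

theorem balTmul_zero_left (π : StarRep R A) (φ : π.space) :
    balTmul π (0 : E) φ = 0 := by
  simp [balTmul]

theorem balTmul_smul_left (π : StarRep R A) (c : Cx R) (x : E) (φ : π.space) :
    balTmul π (c • x) φ = c • balTmul π x φ :=
  rfl

/-- Rieffel induction on `*`-representations: `B` acts on `K` by `b · [x ⊗ φ] = [(b · x) ⊗ φ]`. -/
noncomputable def rieffelRep (h : IsRieffel R B ip) (π : StarRep R A) : StarRep R B where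
  space := rieffelSpace h π
  π :=
    { toFun := rieffelAct h π
      map_smul' := fun c b => rieffel_ext h π fun x φ => by
        simp only [LinearMap.smul_apply, rieffelAct_mk, balLeft_tmul, smul_assoc,
          balTmul_smul_left, map_smul, MonoidHom.id_apply]
      map_zero' := rieffel_ext h π fun x φ => by
        simp only [LinearMap.zero_apply, rieffelAct_mk, balLeft_tmul, zero_smul,
          balTmul_zero_left, map_zero]
      map_add' := fun b b' => rieffel_ext h π fun x φ => by
        simp only [LinearMap.add_apply, rieffelAct_mk, balLeft_tmul, add_smul,
          balTmul_add_left, map_add]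
      map_mul' := fun b b' => rieffel_ext h π fun x φ => by
        simp only [Module.End.mul_apply, rieffelAct_mk, balLeft_tmul, mul_smul] }
  isAdjoint b k l := by
    obtain ⟨k, rfl⟩ := rieffelMk_surjective h π k
    obtain ⟨l, rfl⟩ := rieffelMk_surjective h π l
    exact inducedForm_balLeft h π b k l

/-- Rieffel induction on the objects of `Rep(A)`. -/
noncomputable def rieffelObj (h : IsRieffel R B ip) (π : RepCat R A) : RepCat R B where
  toStarRep := rieffelRep h π.toStarRep
  nondegenerate := by
    refine Submodule.eq_top_iff'.mpr fun k => Submodule.subset_span ⟨1, k, ?_⟩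
    have : rieffelAct h π.toStarRep (1 : B) = LinearMap.id := rieffel_ext h _ fun x φ => by
      rw [rieffelAct_mk, balLeft_tmul, one_smul, LinearMap.id_apply]
    exact (LinearMap.congr_fun this k).symm

/-- The map `x ⊗ φ ↦ x ⊗ U φ`. -/
noncomputable def balMap (E : Type u) [AddCommGroup E] [Module (Cx R) E] [Module Aᵐᵒᵖ E]
    {π ρ : StarRep R A} (U : StarRep.Hom π ρ) :
    BalTensor E π →ₗ[Cx R] BalTensor E ρ :=
  Submodule.mapQ (balancing E π) (balancing E ρ) (LinearMap.lTensor E U.toLin) (by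
    rw [balancing, Submodule.span_le]
    rintro _ ⟨x, a, φ, rfl⟩
    refine Submodule.subset_span ⟨x, a, U.toLin φ, ?_⟩
    simp [U.intertwines])

theorem balMap_tmul {π ρ : StarRep R A} (U : StarRep.Hom π ρ) (x : E) (φ : π.space) :
    balMap E U (balTmul π x φ) = balTmul ρ x (U.toLin φ) :=
  rfl

theorem inducedForm_balMap (h : IsRieffel R B ip) {π ρ : StarRep R A} (U : StarRep.Hom π ρ)
    (k l : BalTensor E π) :
    inducedForm h ρ (balMap E U k) (balMap E U l) = inducedForm h π k l := by
  induction k using balTensor_induction with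
  | h0 => simp
  | ha k k' hk hk' => rw [map_add, map_add, map_add, LinearMap.add_apply, LinearMap.add_apply, hk,
      hk']
  | ht x φ =>
    induction l using balTensor_induction with
    | h0 => simp
    | ha l l' hl hl' => rw [map_add, map_add, map_add, hl, hl']
    | ht y ψ =>
      rw [balMap_tmul, balMap_tmul, (inducedForm_spec h π).tmul, (inducedForm_spec h ρ).tmul,
        ← U.intertwines, U.isometric]

/-- Rieffel induction on isometric intertwiners: `[x ⊗ φ] ↦ [x ⊗ U φ]`. -/
noncomputable def rieffelHom (h : IsRieffel R B ip) {π ρ : StarRep R A} (U : StarRep.Hom π ρ) :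
    StarRep.Hom (rieffelRep h π) (rieffelRep h ρ) where
  toLin := Submodule.mapQ _ _ (balMap E U) (by
    intro k hk
    show inducedForm h ρ (balMap E U k) (balMap E U k) = 0
    rw [inducedForm_balMap]
    exact hk)
  intertwines b k := by
    obtain ⟨k, rfl⟩ := rieffelMk_surjective h π k
    show rieffelMk h ρ (balMap E U (balLeft π b k)) = rieffelMk h ρ (balLeft ρ b (balMap E U k))
    congr 1
    induction k using balTensor_induction with
    | h0 => simp
    | ht x φ => rw [balLeft_tmul, balMap_tmul, balMap_tmul, balLeft_tmul]
    | ha k l hk hl => rw [map_add, map_add, map_add, map_add, hk, hl]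
  isometric k l := by
    obtain ⟨k, rfl⟩ := rieffelMk_surjective h π k
    obtain ⟨l, rfl⟩ := rieffelMk_surjective h π l
    exact inducedForm_balMap h U k l

theorem rieffelHom_mk (h : IsRieffel R B ip) {π ρ : StarRep R A} (U : StarRep.Hom π ρ) (x : E)
    (φ : π.space) : (rieffelHom h U).toLin (rieffelMk h π (balTmul π x φ))
      = rieffelMk h ρ (balTmul ρ x (U.toLin φ)) :=
  rfl

/-- The Rieffel induction functor `Rep(A) ⥤ Rep(B)`. -/
noncomputable def rieffelInduction (h : IsRieffel R B ip) : RepCat R A ⥤ RepCat R B where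
  obj := rieffelObj h
  map U := rieffelHom h U
  map_id _ := StarRep.Hom.ext (rieffel_ext h _ fun _ _ => rfl)
  map_comp _ _ := StarRep.Hom.ext (rieffel_ext h _ fun _ _ => rfl)

end Action

end Rieffel

end StarMorita

open StarMorita

namespace StarMorita

open CategoryTheory TensorProduct MulOpposite

/-! ### Morita contexts -/

section Context

variable {A : Type u} [Ring A] {B : Type u} [Ring B]
  {E : Type u} [AddCommGroup E] [Module B E] [Module Aᵐᵒᵖ E]
  {F : Type u} [AddCommGroup F] [Module A F] [Module Bᵐᵒᵖ F]

/-! The module `E`, its conjugate `Ē` and the pairings (ȳ, x) ↦ ⟨y, x⟩, (x, ȳ) ↦ Θ(x, y) form a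
Morita context: compatibility and its adjoint are the two associativity laws, and fullness writes 1
as a finite sum of values of each pairing (`IsMoritaBimodule.isMoritaContext`).

Part (ii) uses only this context. The sums for 1 are dual bases, so `E` is finitely generated
projective on both sides. The same sums invert the canonical map M → Hom_B(E, Hom_A(F, M))
(`IsMoritaContext.homUnit_bijective`), so the two Hom functors are mutually inverse.

For part (i), write 1 = ∑ β(fᵢ, eᵢ) and send φ to ∑ [fᵢ ⊗ [eᵢ ⊗ φ]]. Moving scalars across the
tensors shows that π(β(g, d))φ goes to [g ⊗ [d ⊗ φ]] (`unitMap_pairing`); this gives both the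
intertwining property and surjectivity. The identity β(f, e)* β(f', e') = ⟨e, ⟨f, f'⟩ e'⟩ makes the
map isometric, hence injective because `H` is definite. The null vectors divided out in the two
inductions therefore need no separate analysis. Exchanging the two sides of the context gives the
other natural isomorphism, with `E` itself in place of the double conjugate. -/

variable (B) in
/-- A pairing `F × E → A` of an `A`-`B` bimodule `F` and a `B`-`A` bimodule `E` which is linear over
`A` on both sides and balanced over `B`. -/
structure IsBalancedPairing (β : F → E → A) : Prop where
  add_left : ∀ f g e, β (f + g) e = β f e + β g e
  add_right : ∀ f d e, β f (d + e) = β f d + β f e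
  smul_left : ∀ (a : A) f e, β (a • f) e = a * β f e
  smul_right : ∀ (a : A) f e, β f (op a • e) = β f e * a
  balanced : ∀ (b : B) f e, β (op b • f) e = β f (b • e)

/-- A Morita context with surjective pairings `β : F × E → A` and `γ : E × F → B`. -/
structure IsMoritaContext (β : F → E → A) (γ : E → F → B) : Prop where
  left : IsBalancedPairing B β
  right : IsBalancedPairing A γ
  assoc_left : ∀ e f e', γ e f • e' = op (β f e') • e
  assoc_right : ∀ f e f', β f e • f' = op (γ e f') • f
  left_one : ∃ (n : ℕ) (f : Fin n → F) (e : Fin n → E), ∑ i, β (f i) (e i) = 1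
  right_one : ∃ (n : ℕ) (e : Fin n → E) (f : Fin n → F), ∑ i, γ (e i) (f i) = 1

variable {β : F → E → A} {γ : E → F → B}

/-! ### Dual bases: finite generation and projectivity -/

theorem IsMoritaContext.symm (h : IsMoritaContext β γ) : IsMoritaContext γ β :=
  ⟨h.right, h.left, h.assoc_right, h.assoc_left, h.right_one, h.left_one⟩

/-- Dual basis argument: from 1 = ∑ γ(eₖ, fₖ) one gets z = ∑ γ(eₖ, fₖ) z = ∑ eₖ β(fₖ, z), so the
identity of `E` factors through a free module of rank n. -/
theorem IsMoritaContext.finite_projective_right (h : IsMoritaContext β γ) :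
    Module.Finite Aᵐᵒᵖ E ∧ Module.Projective Aᵐᵒᵖ E := by
  obtain ⟨n, e, f, hef⟩ := h.right_one
  let i : E →ₗ[Aᵐᵒᵖ] (Fin n → Aᵐᵒᵖ) :=
    { toFun := fun z k => op (β (f k) z)
      map_add' := fun y z => funext fun k => by simp [h.left.add_right]
      map_smul' := fun a z => funext fun k => by
        simpa using congrArg op (h.left.smul_right a.unop (f k) z) }
  let p : (Fin n → Aᵐᵒᵖ) →ₗ[Aᵐᵒᵖ] E := Fintype.linearCombination Aᵐᵒᵖ e
  have hpi : p ∘ₗ i = LinearMap.id := by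
    ext z
    simp [p, i, Fintype.linearCombination_apply, ← h.assoc_left, ← Finset.sum_smul, hef]
  exact ⟨Module.Finite.of_surjective p fun z => ⟨i z, LinearMap.congr_fun hpi z⟩,
    Module.Projective.of_split i p hpi⟩

/-- The mirror image: 1 = ∑ β(fₖ, eₖ) gives z = ∑ z β(fₖ, eₖ) = ∑ γ(z, fₖ) eₖ. -/
theorem IsMoritaContext.finite_projective_left (h : IsMoritaContext β γ) :
    Module.Finite B E ∧ Module.Projective B E := by
  obtain ⟨n, f, e, hfe⟩ := h.left_one
  let i : E →ₗ[B] (Fin n → B) :=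
    { toFun := fun z k => γ z (f k)
      map_add' := fun y z => funext fun k => by simp [h.right.add_left]
      map_smul' := fun b z => funext fun k => by simp [h.right.smul_left] }
  let p : (Fin n → B) →ₗ[B] E := Fintype.linearCombination B e
  have hpi : p ∘ₗ i = LinearMap.id := by
    ext z
    simp [p, i, Fintype.linearCombination_apply, h.assoc_left, ← Finset.sum_smul,
      ← Finset.op_sum, hfe]
  exact ⟨Module.Finite.of_surjective p fun z => ⟨i z, LinearMap.congr_fun hpi z⟩,
    Module.Projective.of_split i p hpi⟩

/-- A balanced pairing whose values span `A` over `k` represents `1` as a sum of values. -/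
theorem IsBalancedPairing.exists_sum_eq_one {k : Type*} [CommRing k] [Algebra k A]
    (h : IsBalancedPairing B β) (hs : Submodule.span k {a : A | ∃ f e, a = β f e} = ⊤) :
    ∃ (n : ℕ) (f : Fin n → F) (e : Fin n → E), ∑ i, β (f i) (e i) = 1 := by
  obtain ⟨n, c, v, hv⟩ := Submodule.mem_span_set'.mp (hs ▸ Submodule.mem_top : (1 : A) ∈ _)
  choose f e hfe using fun i => (v i).2
  -- The coefficients are absorbed into `F` through the elements c • 1 of `A`, so `F` needs no
  -- `k`-module structure.
  refine ⟨n, fun i => (c i • (1 : A)) • f i, e, ?_⟩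
  refine .trans ?_ hv
  exact Finset.sum_congr rfl fun i _ => by rw [h.smul_left, smul_mul_assoc, one_mul, hfe]

/-! ### Hom functors and equivalence of the module categories -/

/-- The abelian group of `A`-linear maps from the `A`-`B` bimodule `F` to `M`, on which `B` acts by
`(b · u) f = u (f · b)`. -/
def BimoduleHom (A F : Type u) [Ring A] [AddCommGroup F] [Module A F] (M : Type u) [AddCommGroup M]
    [Module A M] : Type u :=
  F →ₗ[A] M

variable (M : Type u) [AddCommGroup M] [Module A M]

instance : AddCommGroup (BimoduleHom A F M) := inferInstanceAs (AddCommGroup (F →ₗ[A] M))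

instance : FunLike (BimoduleHom A F M) F M := inferInstanceAs (FunLike (F →ₗ[A] M) F M)

instance : LinearMapClass (BimoduleHom A F M) A F M :=
  inferInstanceAs (LinearMapClass (F →ₗ[A] M) A F M)

instance [SMulCommClass A Bᵐᵒᵖ F] : Module B (BimoduleHom A F M) where
  smul b u :=
    { toFun := fun f => u (op b • f)
      map_add' := fun f g => by rw [smul_add, map_add]
      map_smul' := fun a f => by rw [← smul_comm a (op b) f, map_smul]; rfl }
  one_smul u := LinearMap.ext fun f => congrArg u (one_smul _ f)
  mul_smul b c u := LinearMap.ext fun f => congrArg u (mul_smul (op c) (op b) f)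
  smul_zero b := rfl
  smul_add b u v := rfl
  add_smul b c u := LinearMap.ext fun f => (congrArg u (add_smul (op b) (op c) f)).trans
    (map_add u _ _)
  zero_smul u := LinearMap.ext fun f => (congrArg u (zero_smul _ f)).trans (map_zero u)

variable {M}

theorem BimoduleHom.smul_apply [SMulCommClass A Bᵐᵒᵖ F] (b : B) (u : BimoduleHom A F M) (f : F) :
    (b • u) f = u (op b • f) :=
  rfl

@[ext]
theorem BimoduleHom.ext {u v : BimoduleHom A F M} (huv : ∀ f, u f = v f) : u = v :=
  LinearMap.ext huv

variable (A B F) in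
/-- The functor `M ↦ Hom_A(F, M)` from `A`-modules to `B`-modules. -/
def homFunctor [SMulCommClass A Bᵐᵒᵖ F] : ModuleCat.{u} A ⥤ ModuleCat.{u} B where
  obj M := ModuleCat.of B (BimoduleHom A F M)
  map g := ModuleCat.ofHom
    { toFun := fun u => g.hom ∘ₗ (u : F →ₗ[A] _)
      map_add' := fun u v => LinearMap.comp_add _ _ _
      map_smul' := fun b u => rfl }

variable [SMulCommClass A Bᵐᵒᵖ F] [SMulCommClass B Aᵐᵒᵖ E]

/-- The `A`-linear map `M → Hom_B(E, Hom_A(F, M))`, `m ↦ (e ↦ (f ↦ β(f, e) m))`. -/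
def IsBalancedPairing.homUnit (h : IsBalancedPairing B β) (M : Type u) [AddCommGroup M]
    [Module A M] : M →ₗ[A] BimoduleHom B E (BimoduleHom A F M) where
  toFun m :=
    { toFun := fun e =>
        { toFun := fun f => β f e • m
          map_add' := fun f g => by rw [h.add_left, add_smul]
          map_smul' := fun a f => by rw [h.smul_left, mul_smul]; rfl }
      map_add' := fun d e => LinearMap.ext fun f =>
        (congrArg (· • m) (h.add_right f d e)).trans (add_smul _ _ _)
      map_smul' := fun b e => LinearMap.ext fun f =>
        congrArg (· • m) (h.balanced b f e).symm }
  map_add' m m' := LinearMap.ext fun e => LinearMap.ext fun f => smul_add _ _ _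
  map_smul' a m := LinearMap.ext fun e => LinearMap.ext fun f => by
    show β f e • a • m = β f (op a • e) • m
    rw [h.smul_right, mul_smul]

theorem IsBalancedPairing.homUnit_apply (h : IsBalancedPairing B β) (m : M) (e : E) (f : F) :
    h.homUnit M m e f = β f e • m :=
  rfl

/-- With 1 = ∑ β(fᵢ, eᵢ), the inverse is u ↦ ∑ u(eᵢ)(fᵢ): it recovers m as ∑ β(fᵢ, eᵢ) m, and
linearity of u with both associativity laws shows that it is also a right inverse. -/
theorem IsMoritaContext.homUnit_bijective (h : IsMoritaContext β γ) :
    Function.Bijective (h.left.homUnit M) := by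
  obtain ⟨n, f, e, hfe⟩ := h.left_one
  constructor
  · refine (injective_iff_map_eq_zero _).mpr fun m hm => ?_
    rw [← one_smul A m, ← hfe, Finset.sum_smul]
    refine Finset.sum_eq_zero fun i _ => ?_
    rw [← h.left.homUnit_apply, hm]
    rfl
  · intro u
    refine ⟨∑ i, u (e i) (f i), ?_⟩
    ext d g
    rw [h.left.homUnit_apply, Finset.smul_sum]
    -- β(g, d) fᵢ = g γ(d, fᵢ); the factor γ(d, fᵢ) passes through u by `B`-linearity, and γ(d, fᵢ)
    -- eᵢ = d β(fᵢ, eᵢ).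
    have key : ∀ i, β g d • u (e i) (f i) = u (op (β (f i) (e i)) • d) g := fun i => by
      rw [← map_smul, h.assoc_right, ← BimoduleHom.smul_apply, ← map_smul, h.assoc_left]
    rw [Finset.sum_congr rfl fun i _ => key i]
    let ev : E →+ M :=
      { toFun := fun x => u x g
        map_zero' := by rw [map_zero]; rfl
        map_add' := fun x y => by rw [map_add]; rfl }
    show ∑ i, ev (op (β (f i) (e i)) • d) = ev d
    rw [← map_sum, ← Finset.sum_smul, ← Finset.op_sum, hfe, op_one, one_smul]

/-- `M ≅ Hom_B(E, Hom_A(F, M))`, naturally in `M`. -/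
noncomputable def IsMoritaContext.homUnitIso (h : IsMoritaContext β γ) :
    𝟭 (ModuleCat.{u} A) ≅ homFunctor A B F ⋙ homFunctor B A E :=
  NatIso.ofComponents
    (fun M => (LinearEquiv.ofBijective (h.left.homUnit M) h.homUnit_bijective).toModuleIso)
    fun {M N} g => by
      ext m
      refine BimoduleHom.ext fun e => BimoduleHom.ext fun f => ?_
      exact (map_smul g.hom (β f e) m).symm

open scoped ModuleCat.Algebra in
-- A scalar acts on Hom_A(F, M) through the right `B`-action on `F`, and on `M` through `A`. By `hk`
-- it acts on `F` equally from both sides, so the two actions agree by `A`-linearity.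
theorem homFunctor_linear {k : Type*} [CommRing k] [Algebra k A] [Algebra k B]
    (hk : ∀ (r : k) (f : F), op (algebraMap k B r) • f = algebraMap k A r • f) :
    (homFunctor A B F).Linear k where
  map_smul {M N} g r := by
    ext u
    let u' : BimoduleHom A F M := u
    refine BimoduleHom.ext fun f => ?_
    show algebraMap k A r • g (u' f) = g (u' (op (algebraMap k B r) • f))
    rw [hk, map_smul]
    exact (map_smul g.hom _ _).symm

theorem IsMoritaContext.isMoritaEquivalent (h : IsMoritaContext β γ) {k : Type*} [CommRing k]
    [Algebra k A] [Algebra k B]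
    (hk : ∀ (r : k) (f : F), op (algebraMap k B r) • f = algebraMap k A r • f) :
    IsMoritaEquivalent k A B :=
  ⟨⟨{ eqv := CategoryTheory.Equivalence.mk (homFunctor A B F) (homFunctor B A E) h.homUnitIso
        h.symm.homUnitIso.symm
      linear := homFunctor_linear hk }⟩⟩

/-- Over ℤ the centrality condition on scalars is automatic, which gives Morita equivalence as plain
rings. -/
theorem IsMoritaContext.isMoritaEquivalent_int (h : IsMoritaContext β γ) :
    IsMoritaEquivalent ℤ A B :=
  h.isMoritaEquivalent fun n f => by
    rw [eq_intCast, eq_intCast, op_intCast, Int.cast_smul_eq_zsmul, Int.cast_smul_eq_zsmul]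

end Context

end StarMorita

namespace StarMorita

open CategoryTheory TensorProduct MulOpposite

/-! ### Composition of two Rieffel inductions -/

section Composition

variable {R : Type u} [CommRing R] [LinearOrder R]
  {A : Type u} [Ring A] [StarRing A] [Algebra (Cx R) A]

/-! ### Unital action and isomorphisms in `RepCat` -/

/-- A `StarRep` need not be unital; strong nondegeneracy forces it, since π(1) fixes the spanning
vectors π(a)ψ. The isometry of the unit map depends on this. -/
theorem RepCat.map_one (π : RepCat R A) (φ : π.space) : π.π 1 φ = φ := by
  have hφ : φ ∈ Submodule.span (Cx R) {v : π.space | ∃ a ψ, v = π.π a ψ} :=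
    π.nondegenerate ▸ Submodule.mem_top
  induction hφ using Submodule.span_induction with
  | mem v hv =>
    obtain ⟨a, ψ, rfl⟩ := hv
    rw [← Module.End.mul_apply, ← map_mul, one_mul]
  | zero => rw [map_zero]
  | add v w _ _ hv hw => rw [map_add, hv, hw]
  | smul c v _ hv => rw [map_smul, hv]

section PreHilb

variable (H : PreHilb.{u} R)

theorem PreHilb.inner_sum_right {ι : Type*} (s : Finset ι) (φ : H) (ψ : ι → H) :
    H.inner φ (∑ i ∈ s, ψ i) = ∑ i ∈ s, H.inner φ (ψ i) :=
  map_sum (AddMonoidHom.mk' (H.inner φ) (H.inner_add_right φ)) ψ s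

theorem PreHilb.inner_sum_left {ι : Type*} (s : Finset ι) (φ : ι → H) (ψ : H) :
    H.inner (∑ i ∈ s, φ i) ψ = ∑ i ∈ s, H.inner (φ i) ψ := by
  rw [H.inner_conj_symm, H.inner_sum_right, star_sum]
  exact Finset.sum_congr rfl fun i _ => (H.inner_conj_symm _ _).symm

theorem PreHilb.eq_zero_of_inner_self {φ : H} (hφ : H.inner φ φ = 0) : φ = 0 := by
  by_contra hne
  have hpos := (H.inner_pos φ hne).2
  rw [hφ] at hpos
  exact lt_irrefl _ hpos

end PreHilb

/-- An isometry out of a definite space kills no nonzero vector, so only surjectivity remains to be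
checked for an isomorphism. -/
theorem StarRep.Hom.injective {π ρ : StarRep R A} (U : StarRep.Hom π ρ) :
    Function.Injective U.toLin :=
  (injective_iff_map_eq_zero _).mpr fun φ hφ => π.space.eq_zero_of_inner_self <| by
    rw [← U.isometric, hφ]
    -- Homogeneity with scalar 0 is the source of ⟨0, 0⟩ = 0.
    simpa using ρ.space.inner_smul_right 0 0 0

/-- A surjective isometric intertwiner is an isomorphism in `Rep(A)`. -/
noncomputable def RepCat.isoOfSurjective {π ρ : RepCat R A} (U : π ⟶ ρ)
    (hU : Function.Surjective (StarRep.Hom.toLin U)) : π ≅ ρ :=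
  let e := LinearEquiv.ofBijective (StarRep.Hom.toLin U) ⟨StarRep.Hom.injective U, hU⟩
  { hom := U
    inv :=
      { toLin := e.symm
        intertwines := fun a φ => by
          obtain ⟨ψ, rfl⟩ := e.surjective φ
          refine (e.symm_apply_eq).mpr ?_
          simp only [LinearEquiv.coe_coe, e.symm_apply_apply]
          exact (StarRep.Hom.intertwines U a ψ).symm
        isometric := fun φ ψ => by
          obtain ⟨φ, rfl⟩ := e.surjective φ
          obtain ⟨ψ, rfl⟩ := e.surjective ψ
          simp only [LinearEquiv.coe_coe, e.symm_apply_apply]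
          exact (StarRep.Hom.isometric U φ ψ).symm }
    hom_inv_id := StarRep.Hom.ext (LinearMap.ext fun φ => e.symm_apply_apply φ)
    inv_hom_id := StarRep.Hom.ext (LinearMap.ext fun φ => e.apply_symm_apply φ) }

variable {E : Type u} [AddCommGroup E] [Module (Cx R) E] [Module Aᵐᵒᵖ E]

/-- The map `φ ↦ x ⊗ φ` into `E ⊗_A H`. -/
noncomputable def balTmulRight (π : StarRep R A) (x : E) : π.space →ₗ[Cx R] BalTensor E π :=
  (balancing E π).mkQ ∘ₗ TensorProduct.mk (Cx R) E π.space x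

theorem balTmul_op_smul (π : StarRep R A) (a : A) (x : E) (φ : π.space) :
    balTmul π (op a • x) φ = balTmul π x (π.π a φ) :=
  (Submodule.Quotient.eq _).mpr (Submodule.subset_span ⟨x, a, φ, rfl⟩)

variable [IsStrictOrderedRing R] {B : Type u} [Ring B] [StarRing B] [Algebra (Cx R) B]
  [Module B E] [IsScalarTower (Cx R) B E] [SMulCommClass B Aᵐᵒᵖ E]
  {ip : E → E → A}

/-! ### Calculus of elementary tensors in the induced space -/

section Tmul

/-- The map `φ ↦ [x ⊗ φ]` from `H` to the space of the induced representation. -/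
noncomputable def rieffelTmul (h : IsRieffel R B ip) (π : StarRep R A) (x : E) :
    π.space →ₗ[Cx R] (rieffelRep h π).space :=
  rieffelMk h π ∘ₗ balTmulRight π x

variable (h : IsRieffel R B ip) (π : StarRep R A)

theorem rieffelTmul_add_left (x y : E) (φ : π.space) :
    rieffelTmul h π (x + y) φ = rieffelTmul h π x φ + rieffelTmul h π y φ :=
  (congrArg (rieffelMk h π) (balTmul_add_left π x y φ)).trans (map_add _ _ _)

theorem rieffelTmul_sum_left {ι : Type*} (s : Finset ι) (x : ι → E) (φ : π.space) :
    rieffelTmul h π (∑ i ∈ s, x i) φ = ∑ i ∈ s, rieffelTmul h π (x i) φ :=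
  map_sum (AddMonoidHom.mk' (fun x => rieffelTmul h π x φ) fun x y =>
    rieffelTmul_add_left h π x y φ) x s

theorem rieffelTmul_op_smul (a : A) (x : E) (φ : π.space) :
    rieffelTmul h π (op a • x) φ = rieffelTmul h π x (π.π a φ) :=
  congrArg (rieffelMk h π) (balTmul_op_smul π a x φ)

theorem rieffelRep_tmul (b : B) (x : E) (φ : π.space) :
    (rieffelRep h π).π b (rieffelTmul h π x φ) = rieffelTmul h π (b • x) φ :=
  rfl

theorem inner_rieffelTmul (x y : E) (φ ψ : π.space) :
    (rieffelRep h π).space.inner (rieffelTmul h π x φ) (rieffelTmul h π y ψ)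
      = π.space.inner φ (π.π (ip x y) ψ) :=
  (inducedForm_spec h π).tmul x φ y ψ

theorem rieffelTmul_induction {P : (rieffelRep h π).space → Prop} (h0 : P 0)
    (ht : ∀ x φ, P (rieffelTmul h π x φ)) (ha : ∀ k l, P k → P l → P (k + l)) (k) : P k := by
  obtain ⟨k, rfl⟩ := rieffelMk_surjective h π k
  induction k using balTensor_induction with
  | h0 => exact (map_zero (rieffelMk h π)).symm ▸ h0
  | ht x φ => exact ht x φ
  | ha k l hk hl => exact (map_add (rieffelMk h π) k l).symm ▸ ha _ _ hk hl

end Tmul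

variable {F : Type u} [AddCommGroup F] [Module (Cx R) F] [Module A F] [Module Bᵐᵒᵖ F]
  [IsScalarTower (Cx R) A F] [SMulCommClass A Bᵐᵒᵖ F]
  {ip' : F → F → B} {β : F → E → A} {γ : E → F → B}

/-! ### The natural isomorphism from the identity to the double induction -/

section Unit

variable (h : IsRieffel R B ip) (h' : IsRieffel R A ip') (hc : IsMoritaContext β γ)
  (hβ : ∀ f e f' e', star (β f e) * β f' e' = ip e (ip' f f' • e')) {n : ℕ} {f : Fin n → F}
  {e : Fin n → E} (hfe : ∑ i, β (f i) (e i) = 1)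

/-- The map `φ ↦ ∑ [f i ⊗ [e i ⊗ φ]]` from `H` to the space of the iterated Rieffel induction. -/
noncomputable def unitMap (f : Fin n → F) (e : Fin n → E) (π : StarRep R A) :
    π.space →ₗ[Cx R] (rieffelRep h' (rieffelRep h π)).space :=
  ∑ i, rieffelTmul h' (rieffelRep h π) (f i) ∘ₗ rieffelTmul h π (e i)

theorem unitMap_apply (π : StarRep R A) (φ : π.space) : unitMap h h' f e π φ
    = ∑ i, rieffelTmul h' (rieffelRep h π) (f i) (rieffelTmul h π (e i) φ) := by
  simp [unitMap]

include hc hfe in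
-- Each term moves as fᵢ ⊗ eᵢ ⊗ β(g, d)φ = fᵢ ⊗ eᵢ β(g, d) ⊗ φ = fᵢ ⊗ γ(eᵢ, g) d ⊗ φ = fᵢ γ(eᵢ, g) ⊗
-- d ⊗ φ = β(fᵢ, eᵢ) g ⊗ d ⊗ φ, and the sum over i leaves g.
theorem unitMap_pairing (π : StarRep R A) (g : F) (d : E) (φ : π.space) :
    unitMap h h' f e π (π.π (β g d) φ)
      = rieffelTmul h' (rieffelRep h π) g (rieffelTmul h π d φ) := by
  have key : ∀ i, rieffelTmul h' (rieffelRep h π) (f i) (rieffelTmul h π (e i) (π.π (β g d) φ))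
      = rieffelTmul h' (rieffelRep h π) (β (f i) (e i) • g) (rieffelTmul h π d φ) := fun i => by
    rw [← rieffelTmul_op_smul, ← hc.assoc_left, ← rieffelRep_tmul, ← rieffelTmul_op_smul,
      ← hc.assoc_right]
  rw [unitMap_apply, Finset.sum_congr rfl fun i _ => key i, ← rieffelTmul_sum_left,
    ← Finset.sum_smul, hfe, one_smul]

/-- For a Morita context compatible with the inner products, with `∑ β(f i, e i) = 1`, the
isometric intertwiner `φ ↦ ∑ [f i ⊗ [e i ⊗ φ]]`. -/
noncomputable def unitHom (π : StarRep R A) (hπ : ∀ φ, π.π 1 φ = φ) :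
    StarRep.Hom π (rieffelRep h' (rieffelRep h π)) where
  toLin := unitMap h h' f e π
  intertwines a φ := by
    conv_rhs => rw [unitMap_apply, map_sum]
    simp only [rieffelRep_tmul h']
    -- Each [a fᵢ ⊗ [eᵢ ⊗ φ]] is the image of π(β(a fᵢ, eᵢ))φ, and these pairings sum to a.
    rw [← Finset.sum_congr rfl fun i _ => unitMap_pairing h h' hc hfe π (a • f i) (e i) φ,
      ← map_sum, ← LinearMap.sum_apply, ← map_sum]
    simp only [hc.left.smul_left]
    rw [← Finset.mul_sum, hfe, mul_one]
  isometric φ ψ := by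
    simp only [unitMap_apply, PreHilb.inner_sum_left, PreHilb.inner_sum_right,
      inner_rieffelTmul, rieffelRep_tmul, ← hβ]
    -- By `hβ` the double sum is ⟨φ, π((∑ β(fᵢ, eᵢ))* (∑ β(fⱼ, eⱼ)))ψ⟩ = ⟨φ, π(1)ψ⟩.
    simp only [← PreHilb.inner_sum_right, ← LinearMap.sum_apply, ← map_sum, ← Finset.mul_sum,
      ← Finset.sum_mul, ← star_sum, hfe, mul_one, star_one, hπ]

include hc hfe in
theorem unitMap_surjective (π : StarRep R A) : Function.Surjective (unitMap h h' f e π) := by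
  intro k
  induction k using rieffelTmul_induction with
  | h0 => exact ⟨0, map_zero _⟩
  | ha k l hk hl =>
    obtain ⟨φ, rfl⟩ := hk
    obtain ⟨ψ, rfl⟩ := hl
    exact ⟨φ + ψ, map_add _ _ _⟩
  | ht g v =>
    induction v using rieffelTmul_induction with
    | h0 => exact ⟨0, by rw [map_zero, map_zero]⟩
    | ha k l hk hl =>
      obtain ⟨φ, hφ⟩ := hk
      obtain ⟨ψ, hψ⟩ := hl
      exact ⟨φ + ψ, by rw [map_add, map_add, hφ, hψ]⟩
    | ht d φ => exact ⟨_, unitMap_pairing h h' hc hfe π g d φ⟩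

/-- `φ ↦ ∑ [f i ⊗ [e i ⊗ φ]]` is a natural isomorphism from the identity of `Rep(A)` to the
composite of the two Rieffel inductions. -/
noncomputable def rieffelUnitIso :
    𝟭 (RepCat R A) ≅ rieffelInduction h ⋙ rieffelInduction h' :=
  NatIso.ofComponents
    (fun π => RepCat.isoOfSurjective (ρ := (rieffelInduction h ⋙ rieffelInduction h').obj π)
      (unitHom h h' hc hβ hfe π.toStarRep π.map_one)
      (unitMap_surjective h h' hc hfe π.toStarRep))
    fun {π ρ} U => StarRep.Hom.ext <| LinearMap.ext fun φ => by
      let V : StarRep.Hom π.toStarRep ρ.toStarRep := U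
      show unitMap h h' f e ρ.toStarRep (V.toLin φ)
        = (rieffelHom h' (rieffelHom h V)).toLin (unitMap h h' f e π.toStarRep φ)
      rw [unitMap_apply, unitMap_apply, map_sum]
      rfl

end Unit

end Composition

end StarMorita

namespace StarMorita

open CategoryTheory TensorProduct MulOpposite

/-! ### Morita equivalence bimodules -/

section Bimodule

variable {R : Type u} [CommRing R] [LinearOrder R]
  {A : Type u} [Ring A] [StarRing A] [Algebra (Cx R) A]
  {E : Type u} [AddCommGroup E] [Module (Cx R) E] [Module Aᵐᵒᵖ E]
  {E' : Type u} [AddCommGroup E'] [Module (Cx R) E'] [Module Aᵐᵒᵖ E']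

/-- The induced form pulls back along T ⊗ id. This is needed for the double conjugate of `E`, whose
actions agree with those of `E` only after cancelling two stars. -/
theorem PositivityP.comap {ip : E → E → A} (h : PositivityP R ip) (T : E' →ₗ[Cx R] E)
    (hT : ∀ (a : A) x, T (op a • x) = op a • T x) :
    PositivityP R fun x y => ip (T x) (T y) := by
  intro π
  obtain ⟨s, hs⟩ := h π
  let S : BalTensor E' π →ₗ[Cx R] BalTensor E π :=
    Submodule.mapQ (balancing E' π) (balancing E π) (LinearMap.rTensor π.space T) (by
      rw [balancing, Submodule.span_le]
      rintro _ ⟨x, a, φ, rfl⟩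
      refine Submodule.subset_span ⟨T x, a, φ, ?_⟩
      simp [hT])
  let s' : BalTensor E' π →ₗ⋆[Cx R] BalTensor E' π →ₗ[Cx R] Cx R :=
    LinearMap.mk₂'ₛₗ _ _ (fun k l => s (S k) (S l)) (by simp) (by simp) (by simp) (by simp)
  exact ⟨s', ⟨fun x φ y ψ => hs.tmul (T x) φ (T y) ψ, fun k l => hs.symm (S k) (S l),
    fun k => hs.nonneg (S k)⟩⟩

variable {B : Type u} [Ring B] [StarRing B] [Algebra (Cx R) B] [Module B E]
  {ip : E → E → A} {Θ : E → E → B}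

theorem IsRightInner.add_left (h : IsRightInner R ip) (x y z : E) :
    ip (x + y) z = ip x z + ip y z := by
  rw [h.symm, h.add_right, star_add, ← h.symm, ← h.symm]

/-- The star sits on the acting element, here and in the next lemmas on scalars and on `B`, because
the actions on `Conj E` unfold to this shape. -/
theorem IsRightInner.mul_left (h : IsRightInner R ip) (a : A) (x y : E) :
    ip (op (star a) • x) y = a * ip x y := by
  rw [h.symm, h.mul_right, star_mul, star_star, ← h.symm]

theorem IsRightInner.smul_left [StarModule (Cx R) A] (h : IsRightInner R ip) (c : Cx R)
    (x y : E) : ip (star c • x) y = c • ip x y := by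
  rw [h.symm, h.smul_right, star_smul, star_star, ← h.symm]

theorem IsLeftInner.add_right (h : IsLeftInner R Θ) (x y z : E) :
    Θ x (y + z) = Θ x y + Θ x z := by
  rw [h.symm, h.add_left, star_add, ← h.symm, ← h.symm]

theorem IsLeftInner.mul_right (h : IsLeftInner R Θ) (b : B) (x y : E) :
    Θ x (star b • y) = Θ x y * b := by
  rw [h.symm, h.mul_left, star_mul, star_star, ← h.symm]

theorem IsLeftInner.smul_right [StarModule (Cx R) B] (h : IsLeftInner R Θ) (c : Cx R) (x y : E) :
    Θ x (star c • y) = c • Θ x y := by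
  rw [h.symm, h.smul_left, star_smul, star_star, ← h.symm]

/-- The pairings `(ȳ, x) ↦ ⟨y, x⟩` and `(x, ȳ) ↦ Θ(x, y)` form a Morita context. -/
theorem IsMoritaBimodule.isMoritaContext (h : IsMoritaBimodule R ip Θ) :
    IsMoritaContext (fun (f : Conj E) e => ip (ofConj f) e) (fun e (f : Conj E) => Θ e (ofConj f)) :=
  have hl : IsBalancedPairing B fun (f : Conj E) e => ip (ofConj f) e :=
    { add_left := fun f g e => h.inner.add_left (ofConj f) (ofConj g) e
      add_right := fun f d e => h.inner.add_right (ofConj f) d e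
      smul_left := fun a f e => h.inner.mul_left a (ofConj f) e
      smul_right := fun a f e => h.inner.mul_right (ofConj f) e a
      balanced := fun b f e =>
        (h.inner_compat (star b) (ofConj f) e).trans (by rw [star_star]) }
  have hr : IsBalancedPairing A fun e (f : Conj E) => Θ e (ofConj f) :=
    { add_left := fun d e f => h.theta.add_left d e (ofConj f)
      add_right := fun e f g => h.theta.add_right e (ofConj f) (ofConj g)
      smul_left := fun b e f => h.theta.mul_left b e (ofConj f)
      smul_right := fun b e f => h.theta.mul_right b e (ofConj f)
      balanced := fun a e f =>
        ((h.theta_compat e (ofConj f) (star a)).trans (by rw [star_star])).symm }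
  { left := hl
    right := hr
    assoc_left := fun e f e' => h.compat e (ofConj f) e'
    assoc_right := fun f e f' => by
      -- Once the stars are absorbed by Hermitian symmetry, this is compatibility for the triple
      -- (f', e, f).
      show op (star (ip (ofConj f) e)) • ofConj f' = star (Θ e (ofConj f')) • ofConj f
      rw [← h.inner.symm, ← h.theta.symm, h.compat]
    left_one := hl.exists_sum_eq_one h.inner_full
    right_one := hr.exists_sum_eq_one h.theta_full }

variable [StarModule (Cx R) A] [StarModule (Cx R) B]

/-- The conjugate of a Morita equivalence bimodule is a Morita equivalence bimodule. -/
theorem IsMoritaBimodule.conj (h : IsMoritaBimodule R ip Θ) :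
    IsMoritaBimodule (E := Conj E) R (conjInner Θ) (conjInner ip) where
  inner :=
    { add_right := fun x y z => h.theta.add_right (ofConj x) (ofConj y) (ofConj z)
      smul_right := fun x c y => h.theta.smul_right c (ofConj x) (ofConj y)
      symm := fun x y => h.theta.symm (ofConj x) (ofConj y)
      mul_right := fun x y b => h.theta.mul_right b (ofConj x) (ofConj y)
      pos := fun x => h.theta.pos (ofConj x) }
  inner_compat a x y := by
    show Θ (op (star a) • ofConj x) (ofConj y) = Θ (ofConj x) (op (star (star a)) • ofConj y)
    rw [h.theta_compat, star_star]
  inner_positivity := h.theta_positivity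
  theta :=
    { add_left := fun x y z => h.inner.add_left (ofConj x) (ofConj y) (ofConj z)
      smul_left := fun c x y => h.inner.smul_left c (ofConj x) (ofConj y)
      symm := fun x y => h.inner.symm (ofConj x) (ofConj y)
      mul_left := fun a x y => h.inner.mul_left a (ofConj x) (ofConj y)
      pos := fun x => h.inner.pos (ofConj x) }
  theta_compat x y b := by
    show ip (ofConj x) (star b • ofConj y) = ip (star (star b) • ofConj x) (ofConj y)
    rw [star_star, h.inner_compat]
  theta_positivity :=
    h.inner_positivity.comap
      { toFun := fun x : Conj (Conj E) => ofConj (ofConj x)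
        map_add' := fun _ _ => rfl
        map_smul' := fun c x => congrArg (· • ofConj (ofConj x)) (star_star c) }
      fun a x => congrArg (fun a => op a • ofConj (ofConj x)) (star_star a)
  compat x y z := h.isMoritaContext.assoc_right x (ofConj y) z
  inner_full := h.theta_full
  theta_full := h.inner_full

end Bimodule

end StarMorita

/-! ### The theorem -/

theorem mainTheorem5 {R : Type u} [CommRing R] [LinearOrder R] [IsStrictOrderedRing R]
    {A : Type u} [Ring A] [StarRing A] [Algebra (Cx R) A] [StarModule (Cx R) A]
    {B : Type u} [Ring B] [StarRing B] [Algebra (Cx R) B] [StarModule (Cx R) B]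
    {E : Type u} [AddCommGroup E] [Module (Cx R) E] [Module B E] [Module Aᵐᵒᵖ E]
    [IsScalarTower (Cx R) B E] [IsScalarTower (Cx R) Aᵐᵒᵖ E] [SMulCommClass B Aᵐᵒᵖ E]
    (ip : E → E → A) (Θ : E → E → B) (h : IsMoritaBimodule R ip Θ) :
    (∃ h' : IsMoritaBimodule (E := Conj E) R (conjInner Θ) (conjInner ip),
      ∃ e : CategoryTheory.Equivalence (RepCat R A) (RepCat R B),
        e.functor = rieffelInduction h.isRieffel ∧ e.inverse = rieffelInduction h'.isRieffel) ∧
    IsMoritaEquivalent ℤ A B ∧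
    Module.Finite Aᵐᵒᵖ E ∧ Module.Projective Aᵐᵒᵖ E ∧
    Module.Finite B E ∧ Module.Projective B E := by
  have hc := h.isMoritaContext
  refine ⟨⟨h.conj, ?_⟩, hc.isMoritaEquivalent_int, hc.finite_projective_right.1,
    hc.finite_projective_right.2, hc.finite_projective_left⟩
  obtain ⟨m, f, e, hfe⟩ := hc.left_one
  obtain ⟨n, d, g, hdg⟩ := hc.right_one
  -- `Equivalence.mk` may replace the unit to satisfy the triangle identity but keeps both functors,
  -- so the two equations hold by `rfl`.
  refine ⟨CategoryTheory.Equivalence.mk _ _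
    (rieffelUnitIso h.isRieffel h.conj.isRieffel hc (fun f e f' e' => ?_) hfe)
    (rieffelUnitIso h.conj.isRieffel h.isRieffel hc.symm (fun e f e' f' => ?_) hdg).symm,
    rfl, rfl⟩
  -- ⟨f, e⟩* ⟨f', e'⟩ = ⟨e, f⟩⟨f', e'⟩ = ⟨e, f ⟨f', e'⟩⟩ = ⟨e, Θ(f, f') e'⟩.
  · show star (ip (ofConj f) e) * ip (ofConj f') e' = ip e (Θ (ofConj f) (ofConj f') • e')
    rw [h.compat, h.inner.mul_right, ← h.inner.symm]
  -- Θ(e, f)* Θ(e', f') = Θ(f, e) Θ(e', f') = Θ(Θ(f, e) e', f') = Θ(f ⟨e, e'⟩, f'); the starred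
  -- operator on f' is the left action of ⟨e, e'⟩ on the conjugate.
  · show star (Θ e (ofConj f)) * Θ e' (ofConj f')
      = Θ (ofConj f) (MulOpposite.op (star (ip e e')) • ofConj f')
    rw [h.theta_compat, star_star, ← h.compat, h.theta.mul_left, ← h.theta.symm]
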